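/- Let $\alpha>0$, $\kappa>0$ and $0<\epsilon<1$ be fixed. For $n\ge 1$ equip the complete graph $K_n$ with unit conductances and constant killing factor $\kappa$, so that the transition matrix is $P_{x,y}=\frac{1}{n-1+\kappa}$ for $x\ne y$ and $P_{x,x}=0$. A discrete oriented loop is a sequence of vertices $(x_1,\dots,x_k)$, $k\ge 2$, with $x_i\neq x_{i+1}$ for $1\le i<k$ and $x_k\ne x_1$, considered up to cyclic rotation; $k$ is its length. Let $\nu_n$ be the measure on loops giving to each loop the mass $P_{x_1,x_2}P_{x_2,x_3}\cdots P_{x_k,x_1}$ divided by its multiplicity (the largest $m$ such that the loop is the $m$-fold repetition of some loop), and let $\mathcal{DL}_\alpha$ be a Poisson process of loops on $K_n$ with intensity $\alpha\nu_n$. Let $\mathcal C_\alpha$ be the partition of the vertex set into the connected components (clusters, isolated vertices included) of the graph formed by the edges traversed by at least one loop of $\mathcal{DL}_\alpha$. Then, as $n\to\infty$, $$\mathbb P\big(\mathcal C_\alpha \text{ has a cluster with more than } n^{1-\epsilon}\text{ vertices}\big)\longrightarrow 1 .$$ Moreover, as $n\to\infty$, the probability that $\mathcal{DL}_\alpha$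 contains a loop of length larger than $n^{1-\epsilon}$ which visits more than $(1-\epsilon)n^{1-\epsilon}$ distinct vertices converges to $1$. -/

import Mathlib

open MeasureTheory ProbabilityTheory Filter Topology
open scoped NNReal ENNReal

noncomputable section

/-- A graph on the vertex set `V` without self-loops, equipped with symmetric conductances `C x y`
(positive exactly on the edges) and a nonnegative killing function. -/
structure LoopNetwork (V : Type*) where
  /-- the conductances -/
  cond : V → V → ℝ≥0
  cond_symm : ∀ x y, cond x y = cond y x
  cond_self : ∀ x, cond x x = 0
  /-- the killing function -/
  kill : V → ℝ≥0

/-- The underlying graph: the edges are the pairs with a nonzero conductance. -/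
def LoopNetwork.graph {V : Type*} (N : LoopNetwork V) : SimpleGraph V where
  Adj x y := N.cond x y ≠ 0
  symm := ⟨fun x y h => by rwa [N.cond_symm y x]⟩
  loopless := ⟨fun x h => h (N.cond_self x)⟩

/-- `λ_x = ∑_y C_{x,y} + κ_x`. -/
def LoopNetwork.rate {V : Type*} [Fintype V] (N : LoopNetwork V) (x : V) : ℝ≥0 :=
  ∑ y, N.cond x y + N.kill x

/-- The (sub-Markovian) transition matrix `P_{x,y} = C_{x,y} / λ_x`. -/
def LoopNetwork.trans {V : Type*} [Fintype V] (N : LoopNetwork V) (x y : V) : ℝ≥0 :=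
  N.cond x y / N.rate x

/-- Discrete oriented loops: based loops `(x₁, …, x_k)`, `k ≥ 2`, with `x_i` adjacent to `x_{i+1}`
and `x_k` adjacent to `x₁`, up to cyclic rotation. -/
def DiscreteLoop {V : Type*} (G : SimpleGraph V) : Type _ :=
  {c : Cycle V // 2 ≤ c.length ∧ c.Chain G.Adj}

/-- The product `f x₁ x₂ * f x₂ x₃ * ⋯ * f x_k x₁` along a based loop `[x₁, …, x_k]`. -/
def listEdgeProd {V : Type*} (f : V → V → ℝ≥0) (l : List V) : ℝ≥0 :=
  (List.zipWith f l (l.rotate 1)).prod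

theorem listEdgeProd_rotate {V : Type*} (f : V → V → ℝ≥0) (l : List V) (n : ℕ) :
    listEdgeProd f (l.rotate n) = listEdgeProd f l := by
  unfold listEdgeProd
  rw [List.rotate_rotate, Nat.add_comm n 1, ← List.rotate_rotate,
    ← List.zipWith_rotate_distrib f l (l.rotate 1) n (List.length_rotate l 1).symm]
  exact (List.rotate_perm _ _).prod_eq

/-- The product of the values of `f` over the edges of a cycle. -/
def cycleEdgeProd {V : Type*} (f : V → V → ℝ≥0) (c : Cycle V) : ℝ≥0 :=
  Quotient.liftOn c (listEdgeProd f) (by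
    rintro a b ⟨n, rfl⟩
    exact (listEdgeProd_rotate f a n).symm)

/-- The multiplicity of a loop: the largest `m` such that the loop is the `m`-fold repetition of
another one. -/
def cycleMultiplicity {V : Type*} (c : Cycle V) : ℕ :=
  sSup {m : ℕ | ∃ b : List V, c = (((List.replicate m b).flatten : List V) : Cycle V)}

/-- The loop measure `ν`, given by its mass at each loop: the product of the transition
probabilities of the edges of the loop divided by the multiplicity of the loop. -/
def LoopNetwork.loopMass {V : Type*} [Fintype V] (N : LoopNetwork V)
    (l : DiscreteLoop N.graph) : ℝ≥0 :=
  cycleEdgeProd N.trans l.1 / (cycleMultiplicity l.1 : ℝ≥0)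

/-- A loop configuration is a multiset of loops, encoded by the number of copies of each loop. -/
abbrev LoopConfig {V : Type*} (G : SimpleGraph V) : Type _ := DiscreteLoop G → ℕ

/-- The law of the Poisson process `𝓓𝓛_α` of loops with intensity `α ν`. As the set of loops is
countable and discrete, this means that the numbers of copies of the loops `l` are independent
Poisson variables with parameters `α ν(l)`. -/
def LoopNetwork.loopEnsemble {V : Type*} [Fintype V] (N : LoopNetwork V) (α : ℝ≥0) :
    Measure (LoopConfig N.graph) :=
  Measure.infinitePi fun l => poissonMeasure (α * N.loopMass l)

/-- The cycle `c` traverses the oriented edge from `x` to `y`. -/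
def CycleTraverses {V : Type*} (c : Cycle V) (x y : V) : Prop :=
  ∃ t : List V, c = ((x :: y :: t : List V) : Cycle V)

/-- The graph of the edges occupied by a loop configuration, that is, traversed (in one direction
or the other) by at least one of its loops. -/
def occupiedGraph {V : Type*} {G : SimpleGraph V} (ω : LoopConfig G) : SimpleGraph V :=
  SimpleGraph.fromRel fun x y => ∃ l : DiscreteLoop G, 0 < ω l ∧ CycleTraverses l.1 x y

/-- The clusters of a loop configuration: the blocks of the partition of the vertex set into the
connected components of the graph of occupied edges (isolated vertices included). -/
def loopClusters {V : Type*} {G : SimpleGraph V} (ω : LoopConfig G) : Set (Set V) :=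
  {B | ∃ K : (occupiedGraph ω).ConnectedComponent, B = K.supp}

/-- The set of vertices visited by a loop. -/
def DiscreteLoop.vertices {V : Type*} {G : SimpleGraph V} (l : DiscreteLoop G) : Set V :=
  {x | x ∈ l.1}

/-- The complete graph `K_n` with unit conductances and constant killing factor `κ`. -/
def completeNetwork (n : ℕ) (κ : ℝ≥0) : LoopNetwork (Fin n) where
  cond x y := if x = y then 0 else 1
  cond_symm x y := by simp only [eq_comm]
  cond_self x := if_pos rfl
  kill _ := κ

end

/-!
A pair of distinct indices of a walk of length `k` in `K_n` collides for `n ^ (k - 1)` of the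
`n ^ k` walks, so by Markov's inequality at most `2 k n ^ (k - 1)` walks visit at most `k / 2`
vertices, while at most `k n ^ (k - 1)` have two equal cyclically consecutive vertices. Hence, if
`6 k ≤ n`, at least half of the `n ^ k` walks are based loops visiting more than `k / 2` vertices.
An `m`-fold repetition visits each of its vertices at least `m` times, so these loops have
multiplicity one, and each of them has at most `k` base points: their total mass is at least
`n ^ k (n + κ) ^ (-k) / (2 k) ≥ exp (-κ) / (2 k)`. Summing over `a < k ≤ b` gives a harmonic sum, of
order `log (b / a)`, and the probability that the Poisson process contains no such loop is at most
`((a + 1) / (b + 1)) ^ (α exp (-κ) / 2)`. This tends to zero when `a = o(n)` and `b = ⌊n / 6⌋`.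
-/

open Asymptotics

section Collisions

variable {ι V : Type*} [Fintype ι]

/-- The ordered pairs of distinct indices at which `x` takes the same value; their number measures
how far `x` is from being injective. -/
def collisions [DecidableEq V] (x : ι → V) : Finset (ι × ι) :=
  {p ∈ Finset.univ.offDiag | x p.1 = x p.2}

theorem card_le_ncard_range_add_card_collisions [DecidableEq V] (x : ι → V) :
    Fintype.card ι ≤ (Set.range x).ncard + (collisions x).card := by
  obtain ⟨s, -, hs⟩ := Set.exists_subset_bijOn Set.univ x
  rw [Set.image_univ] at hs
  have hsub : sᶜ ⊆ Prod.fst '' (collisions x : Set (ι × ι)) := by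
    intro i hi
    obtain ⟨j, hj, hji⟩ := hs.surjOn ⟨i, rfl⟩
    have hij : i ≠ j := fun h => hi (h ▸ hj)
    exact ⟨(i, j), by simp [collisions, hij, hji], rfl⟩
  calc Fintype.card ι = s.ncard + sᶜ.ncard := by
        rw [Set.ncard_add_ncard_compl, Nat.card_eq_fintype_card]
    _ ≤ (Set.range x).ncard + (collisions x).card := by
        gcongr
        · rw [← hs.image_eq, hs.injOn.ncard_image]
        · rw [← Set.ncard_coe_finset]
          exact (Set.ncard_le_ncard hsub).trans (Set.ncard_image_le (Set.toFinite _))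

variable [DecidableEq ι] [Fintype V]

theorem card_filter_apply_eq_apply_le [DecidableEq V] {i j : ι} (hij : i ≠ j) :
    (Finset.univ.filter fun x : ι → V => x i = x j).card ≤
      Fintype.card V ^ (Fintype.card ι - 1) := by
  have hcard : Fintype.card ({l : ι // l ≠ j} → V) = Fintype.card V ^ (Fintype.card ι - 1) := by
    simp [Fintype.card_subtype_compl]
  rw [← hcard, ← Finset.card_univ]
  refine Finset.card_le_card_of_injOn (fun x l => x l.1) (fun _ _ => Finset.mem_univ _) ?_
  intro x hx y hy hxy
  have hx : x i = x j := (Finset.mem_filter.1 hx).2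
  have hy : y i = y j := (Finset.mem_filter.1 hy).2
  have hagree (l : ι) (hl : l ≠ j) : x l = y l := congrFun hxy ⟨l, hl⟩
  funext l
  obtain rfl | hl := eq_or_ne l j
  · rw [← hx, ← hy, hagree i hij]
  · exact hagree l hl

theorem sum_card_collisions_le [DecidableEq V] :
    ∑ x : ι → V, (collisions x).card ≤
      Fintype.card ι ^ 2 * Fintype.card V ^ (Fintype.card ι - 1) := by
  calc ∑ x : ι → V, (collisions x).card
      = ∑ p ∈ Finset.univ.offDiag, (Finset.univ.filter fun x : ι → V => x p.1 = x p.2).card := by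
        simp only [collisions, Finset.card_filter]
        exact Finset.sum_comm
    _ ≤ Finset.univ.offDiag.card * Fintype.card V ^ (Fintype.card ι - 1) :=
        Finset.sum_le_card_nsmul _ _ _ fun p hp =>
          card_filter_apply_eq_apply_le (Finset.mem_offDiag.1 hp).2.2
    _ ≤ Fintype.card ι ^ 2 * Fintype.card V ^ (Fintype.card ι - 1) := by
        gcongr
        rw [Finset.offDiag_card, Finset.card_univ, sq]
        exact Nat.sub_le _ _

/-- Markov's inequality for the number of collisions. -/
theorem card_filter_two_mul_ncard_range_le [Nonempty ι] :
    (Finset.univ.filter fun x : ι → V => 2 * (Set.range x).ncard ≤ Fintype.card ι).card ≤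
      2 * Fintype.card ι * Fintype.card V ^ (Fintype.card ι - 1) := by
  classical
  set s := Finset.univ.filter fun x : ι → V => 2 * (Set.range x).ncard ≤ Fintype.card ι
  refine Nat.le_of_mul_le_mul_right ?_ (Fintype.card_pos (α := ι))
  calc s.card * Fintype.card ι ≤ ∑ x ∈ s, 2 * (collisions x).card := by
        rw [← smul_eq_mul]
        refine Finset.card_nsmul_le_sum _ _ _ fun x hx => ?_
        have hx : 2 * (Set.range x).ncard ≤ Fintype.card ι := (Finset.mem_filter.1 hx).2
        have := card_le_ncard_range_add_card_collisions x
        omega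
    _ ≤ ∑ x : ι → V, 2 * (collisions x).card :=
        Finset.sum_le_sum_of_subset (Finset.subset_univ s)
    _ ≤ 2 * (Fintype.card ι ^ 2 * Fintype.card V ^ (Fintype.card ι - 1)) := by
        rw [← Finset.mul_sum]
        gcongr
        exact sum_card_collisions_le
    _ = 2 * Fintype.card ι * Fintype.card V ^ (Fintype.card ι - 1) * Fintype.card ι := by ring

theorem card_filter_exists_apply_eq_le {σ : ι → ι} (hσ : ∀ i, σ i ≠ i)
    [DecidablePred fun x : ι → V => ∃ i, x i = x (σ i)] :
    (Finset.univ.filter fun x : ι → V => ∃ i, x i = x (σ i)).card ≤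
      Fintype.card ι * Fintype.card V ^ (Fintype.card ι - 1) := by
  classical
  have hunion : (Finset.univ.filter fun x : ι → V => ∃ i, x i = x (σ i)) =
      Finset.univ.biUnion fun i => Finset.univ.filter fun x : ι → V => x i = x (σ i) := by
    ext x
    simp
  rw [hunion]
  exact Finset.card_biUnion_le_card_mul _ _ _ fun i _ => card_filter_apply_eq_apply_le (hσ i).symm

end Collisions

theorem log_div_le_sum_Ioc_inv (a b : ℕ) :
    Real.log ((b + 1) / (a + 1)) ≤ ∑ k ∈ Finset.Ioc a b, (k : ℝ)⁻¹ := by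
  rw [Real.log_div (by positivity) (by positivity)]
  obtain hab | hba := le_total a b
  · have hharmonic : (harmonic b : ℝ) - harmonic a = ∑ k ∈ Finset.Ioc a b, (k : ℝ)⁻¹ := by
      induction b, hab using Nat.le_induction with
      | base => simp
      | succ b hab ih =>
        rw [Finset.sum_Ioc_succ_top hab, ← ih, harmonic_succ]
        push_cast
        ring
    have := Real.strictMono_eulerMascheroniSeq.monotone hab
    simp only [Real.eulerMascheroniSeq] at this
    linarith
  · rw [Finset.Ioc_eq_empty_of_le hba, Finset.sum_empty, sub_nonpos]
    gcongr

theorem isLittleO_natCast_rpow {r : ℝ} (hr : r < 1) :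
    (fun n : ℕ => (n : ℝ) ^ r) =o[atTop] fun n : ℕ => (n : ℝ) := by
  refine (isLittleO_of_tendsto' ?_ ?_ : (fun x : ℝ => x ^ r) =o[atTop] id).natCast_atTop
  · filter_upwards [eventually_ne_atTop 0] with x hx h0 using absurd h0 hx
  · refine (tendsto_rpow_neg_atTop (sub_pos.2 hr)).congr' ?_
    filter_upwards [eventually_gt_atTop 0] with x hx
    rw [neg_sub, Real.rpow_sub_one hx.ne', id]

theorem exp_neg_le_pow_mul_inv_pow {κ : ℝ} (hκ : 0 ≤ κ) {n k : ℕ} (hn : 0 < n) (hkn : k ≤ n) :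
    Real.exp (-κ) ≤ (n : ℝ) ^ k * ((n + κ)⁻¹) ^ k := by
  have hn0 : (0 : ℝ) < n := Nat.cast_pos.2 hn
  calc Real.exp (-κ) ≤ Real.exp (k * (-(κ / n))) := by
        rw [Real.exp_le_exp, mul_neg, neg_le_neg_iff, mul_div_left_comm]
        exact mul_le_of_le_one_right hκ ((div_le_one hn0).2 (Nat.cast_le.2 hkn))
    _ = (Real.exp (κ / n))⁻¹ ^ k := by rw [Real.exp_nat_mul, Real.exp_neg]
    _ ≤ (κ / n + 1)⁻¹ ^ k := by gcongr; exact Real.add_one_le_exp _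
    _ = (n : ℝ) ^ k * ((n + κ)⁻¹) ^ k := by rw [← mul_pow]; congr 1; field_simp; ring

theorem infinitePi_poissonMeasure_exists_pos {ι : Type*} (r : ι → ℝ≥0) (s : Finset ι) :
    Measure.infinitePi (fun i => poissonMeasure (r i)) {ω | ∃ i ∈ s, 0 < ω i} =
      ENNReal.ofReal (1 - Real.exp (-∑ i ∈ s, (r i : ℝ))) := by
  have hcompl : {ω : ι → ℕ | ∃ i ∈ s, 0 < ω i} = (Set.pi s fun _ => {0})ᶜ := by
    ext ω
    simp [Set.mem_pi, Nat.pos_iff_ne_zero]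
  have hpi : Measure.infinitePi (fun i => poissonMeasure (r i)) (Set.pi s fun _ => {0}) =
      ENNReal.ofReal (Real.exp (-∑ i ∈ s, (r i : ℝ))) := by
    rw [Measure.infinitePi_pi _ fun _ _ => measurableSet_singleton _, ← Finset.sum_neg_distrib,
      Real.exp_sum, ENNReal.ofReal_prod_of_nonneg fun _ _ => Real.exp_nonneg _]
    simp [poissonMeasure_singleton]
  rw [hcompl, prob_compl_eq_one_sub (.pi s.countable_toSet fun _ _ => measurableSet_singleton _),
    hpi, ENNReal.ofReal_sub _ (Real.exp_nonneg _), ENNReal.ofReal_one]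

theorem tendsto_measure_one_of_subset {ι : Type*} {l : Filter ι} {Ω : ι → Type*}
    [∀ i, MeasurableSpace (Ω i)] {μ : ∀ i, Measure (Ω i)} [∀ i, IsProbabilityMeasure (μ i)]
    {s t : ∀ i, Set (Ω i)} (hs : Tendsto (fun i => μ i (s i)) l (𝓝 1)) (hst : ∀ i, s i ⊆ t i) :
    Tendsto (fun i => μ i (t i)) l (𝓝 1) :=
  tendsto_of_tendsto_of_tendsto_of_le_of_le hs tendsto_const_nhds
    (fun i => measure_mono (hst i)) fun _ => prob_le_one

section Cycles

variable {V : Type*} {k : ℕ}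

theorem exists_coe_ofFn_eq (c : Cycle V) :
    ∃ (k : ℕ) (x : Fin k → V), (List.ofFn x : Cycle V) = c :=
  Quotient.inductionOn' c fun l => ⟨l.length, l.get, congrArg _ (List.ofFn_get l)⟩

theorem setOf_mem_coe_ofFn (x : Fin k → V) : {v | v ∈ (List.ofFn x : Cycle V)} = Set.range x := by
  ext v
  simp

theorem rotate_one_ofFn (x : Fin k → V) :
    (List.ofFn x).rotate 1 = List.ofFn (x ∘ finRotate k) := by
  refine List.ext_getElem (by simp) fun i _ hi => ?_
  have hik : i < k := by simpa only [List.length_ofFn] using hi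
  obtain ⟨m, rfl⟩ : ∃ m, k = m + 1 := Nat.exists_eq_succ_of_ne_zero (by omega)
  have hrot : finRotate (m + 1) ⟨i, hik⟩ = ⟨(i + 1) % (m + 1), Nat.mod_lt _ m.succ_pos⟩ := by
    simp [Fin.ext_iff, Fin.val_add]
  simp only [List.getElem_rotate, List.getElem_ofFn, Function.comp_apply, List.length_ofFn, hrot]

theorem listEdgeProd_ofFn (f : V → V → ℝ≥0) (x : Fin k → V) :
    listEdgeProd f (List.ofFn x) = ∏ i, f (x i) (x (finRotate k i)) := by
  rw [listEdgeProd, rotate_one_ofFn, ← List.prod_ofFn]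
  congr 1
  exact List.ext_getElem (by simp) (by simp)

theorem chain_coe_ofFn {r : V → V → Prop} {x : Fin k → V} :
    Cycle.Chain r (List.ofFn x : Cycle V) ↔ ∀ i, r (x i) (x (finRotate k i)) := by
  cases k with
  | zero => simp
  | succ k =>
    have hstep (i : ℕ) (hi : i < k) :
        finRotate (k + 1) ⟨i, hi.trans k.lt_succ_self⟩ = ⟨i + 1, Nat.succ_lt_succ hi⟩ :=
      finRotate_of_lt hi
    have hlast : r ((List.ofFn x).getLast (by simp)) (x 0) ↔
        r (x (Fin.last k)) (x (finRotate (k + 1) (Fin.last k))) := by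
      rw [List.getLast_ofFn, finRotate_last]
      rfl
    rw [Cycle.chain_ne_nil r (by simp), List.isChain_cons, List.isChain_ofFn,
      Fin.forall_fin_succ', and_comm, ← hlast]
    simp [Fin.forall_iff, hstep]

theorem cycleTraverses_coe_ofFn (hk : 2 ≤ k) (x : Fin k → V) (i : Fin k) :
    CycleTraverses (List.ofFn x : Cycle V) (x i) (x (finRotate k i)) := by
  obtain ⟨m, rfl⟩ : ∃ m, k = m + 2 := Nat.exists_eq_add_of_le' hk
  have hrot : (List.ofFn x).rotate i = List.ofFn fun j => x (j + i) := by
    refine List.ext_getElem (by simp) fun j _ _ => ?_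
    simp [List.getElem_rotate, -List.ofFn_succ, Fin.add_def]
  refine ⟨List.ofFn fun j : Fin m => x (j.succ.succ + i), Cycle.coe_eq_coe.2 ⟨i, ?_⟩⟩
  rw [hrot]
  simp [add_comm]

theorem card_filter_coe_ofFn_eq_le [DecidableEq V] (hk : k ≠ 0) (s : Finset (Fin k → V))
    (c : Cycle V) : (s.filter fun x => (List.ofFn x : Cycle V) = c).card ≤ k := by
  obtain hempty | ⟨x₀, hx₀⟩ := (s.filter fun x => (List.ofFn x : Cycle V) = c).eq_empty_or_nonempty
  · simp [hempty]
  obtain rfl := (Finset.mem_filter.1 hx₀).2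
  calc _ ≤ (List.ofFn x₀).cyclicPermutations.toFinset.card := by
        refine Finset.card_le_card_of_injOn List.ofFn (fun x hx => ?_) List.ofFn_injective.injOn
        have hx := (Finset.mem_filter.1 hx).2
        exact List.mem_toFinset.2 (List.mem_cyclicPermutations_iff.2 (Cycle.coe_eq_coe.1 hx))
    _ ≤ (List.ofFn x₀).cyclicPermutations.length := List.toFinset_card_le _
    _ = k := by
        rw [List.length_cyclicPermutations_of_ne_nil _ (mt List.ofFn_eq_nil_iff.1 hk),
          List.length_ofFn]

theorem ncard_setOf_mem_le_length (c : Cycle V) : {v | v ∈ c}.ncard ≤ c.length := by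
  obtain ⟨k, x, rfl⟩ := exists_coe_ofFn_eq c
  rw [setOf_mem_coe_ofFn, ← Nat.card_coe_set_eq, Cycle.length_coe, List.length_ofFn]
  simpa using Finite.card_range_le x

theorem mul_ncard_setOf_mem_le_length {c : Cycle V} {b : List V} {m : ℕ}
    (h : c = ((List.replicate m b).flatten : List V)) : m * {v | v ∈ c}.ncard ≤ c.length := by
  subst h
  have hsub : {v | v ∈ ((List.replicate m b).flatten : Cycle V)} ⊆ {v | v ∈ (b : Cycle V)} := by
    intro v hv
    obtain ⟨b', hb', hv⟩ := List.mem_flatten.1 hv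
    exact List.eq_of_mem_replicate hb' ▸ hv
  calc _ ≤ m * b.length :=
        Nat.mul_le_mul_left _ <| (Set.ncard_le_ncard hsub b.finite_toSet).trans
          (ncard_setOf_mem_le_length (b : Cycle V))
    _ = _ := by simp

theorem cycleMultiplicity_eq_one {c : Cycle V} (hc : c.length < 2 * {v | v ∈ c}.ncard) :
    cycleMultiplicity c = 1 := by
  have hle : ∀ m ∈ {m : ℕ | ∃ b : List V, c = ((List.replicate m b).flatten : List V)}, m ≤ 1 := by
    rintro m ⟨b, hb⟩
    have hlt := (mul_ncard_setOf_mem_le_length hb).trans_lt hc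
    exact Nat.lt_succ_iff.1 (lt_of_mul_lt_mul_right hlt (Nat.zero_le _))
  have hone : ∃ b : List V, c = ((List.replicate 1 b).flatten : List V) := by
    obtain ⟨k, x, rfl⟩ := exists_coe_ofFn_eq c
    exact ⟨List.ofFn x, by simp⟩
  exact le_antisymm (csSup_le' hle) (le_csSup ⟨1, hle⟩ hone)

theorem pow_length_le_cycleEdgeProd {r : V → V → Prop} {f : V → V → ℝ≥0} {p : ℝ≥0}
    (hp : ∀ u v, r u v → p ≤ f u v) {c : Cycle V} (hc : c.Chain r) :
    p ^ c.length ≤ cycleEdgeProd f c := by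
  obtain ⟨k, x, rfl⟩ := exists_coe_ofFn_eq c
  rw [chain_coe_ofFn] at hc
  calc p ^ (List.ofFn x : Cycle V).length = ∏ _ : Fin k, p := by simp
    _ ≤ ∏ i, f (x i) (x (finRotate k i)) := Finset.prod_le_prod' fun i _ => hp _ _ (hc i)
    _ = cycleEdgeProd f (List.ofFn x : Cycle V) := (listEdgeProd_ofFn f x).symm

end Cycles

section Loops

variable {V : Type*} {G : SimpleGraph V}

theorem DiscreteLoop.ncard_vertices_le_length (l : DiscreteLoop G) :
    l.vertices.ncard ≤ l.1.length :=
  ncard_setOf_mem_le_length l.1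

theorem reachable_occupiedGraph {ω : LoopConfig G} {l : DiscreteLoop G} (hl : 0 < ω l) {u v : V}
    (hu : u ∈ l.vertices) (hv : v ∈ l.vertices) : (occupiedGraph ω).Reachable u v := by
  have : IsTrans V (occupiedGraph ω).Reachable := ⟨fun _ _ _ => .trans⟩
  suffices hchain : l.1.Chain (occupiedGraph ω).Reachable from
    Cycle.chain_iff_pairwise.1 hchain u hu v hv
  obtain ⟨c, hlength, hc⟩ := l
  obtain ⟨k, x, rfl⟩ := exists_coe_ofFn_eq c
  rw [Cycle.length_coe, List.length_ofFn] at hlength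
  refine chain_coe_ofFn.2 fun i => ?_
  have hne : x i ≠ x (finRotate k i) := (chain_coe_ofFn.1 hc i).ne
  exact (SimpleGraph.fromRel_adj ..).2
    ⟨hne, .inl ⟨_, hl, cycleTraverses_coe_ofFn hlength x i⟩⟩ |>.reachable

theorem exists_mem_loopClusters_vertices_subset {ω : LoopConfig G} {l : DiscreteLoop G}
    (hl : 0 < ω l) : ∃ B ∈ loopClusters ω, l.vertices ⊆ B := by
  obtain ⟨u, hu⟩ : l.vertices.Nonempty := by
    obtain ⟨c, hlength, hc⟩ := l
    obtain ⟨k, x, rfl⟩ := exists_coe_ofFn_eq c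
    rw [Cycle.length_coe, List.length_ofFn] at hlength
    exact ⟨x ⟨0, by omega⟩, by simp [DiscreteLoop.vertices]⟩
  exact ⟨_, ⟨(occupiedGraph ω).connectedComponentMk u, rfl⟩, fun v hv =>
    SimpleGraph.ConnectedComponent.eq.2 (reachable_occupiedGraph hl hv hu)⟩

theorem LoopNetwork.pow_length_le_loopMass [Fintype V] {N : LoopNetwork V} {p : ℝ≥0}
    (hp : ∀ u v, N.graph.Adj u v → p ≤ N.trans u v) {l : DiscreteLoop N.graph}
    (hl : l.1.length < 2 * l.vertices.ncard) : p ^ l.1.length ≤ N.loopMass l := by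
  rw [LoopNetwork.loopMass, cycleMultiplicity_eq_one hl, Nat.cast_one, div_one]
  exact pow_length_le_cycleEdgeProd hp l.2.2

end Loops

section SpreadLoops

variable {V : Type*} [Fintype V] {k : ℕ}

open scoped Classical in
/-- The based loops of length `k` in `G` that visit more than `k / 2` vertices. Such a loop has
multiplicity one, while most closed walks of length `k ≤ card V / 6` in the complete graph are of
this kind. -/
noncomputable def spreadWalks (G : SimpleGraph V) (k : ℕ) : Finset (Fin k → V) :=
  {x | (∀ i, G.Adj (x i) (x (finRotate k i))) ∧ k < 2 * (Set.range x).ncard}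

open scoped Classical in
/-- The loops represented by the spread walks of length `k`. -/
noncomputable def spreadLoops (G : SimpleGraph V) (k : ℕ) : Finset (DiscreteLoop G) :=
  ((spreadWalks G k).image fun x => (List.ofFn x : Cycle V)).subtype _

variable {G : SimpleGraph V}

theorem mem_spreadLoops {l : DiscreteLoop G} :
    l ∈ spreadLoops G k ↔ l.1.length = k ∧ k < 2 * l.vertices.ncard := by
  classical
  refine Finset.mem_subtype.trans ?_
  simp only [Finset.mem_image, spreadWalks, Finset.mem_filter_univ]
  constructor
  · rintro ⟨x, ⟨-, hx⟩, hxl⟩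
    rw [← setOf_mem_coe_ofFn, hxl] at hx
    exact ⟨by simp [← hxl], hx⟩
  · obtain ⟨c, -, hc⟩ := l
    obtain ⟨m, x, rfl⟩ := exists_coe_ofFn_eq c
    rintro ⟨hm, hx⟩
    obtain rfl : m = k := by simpa using hm
    refine ⟨x, ⟨chain_coe_ofFn.1 hc, ?_⟩, rfl⟩
    rwa [← setOf_mem_coe_ofFn]

theorem card_spreadWalks_le (hk : 2 ≤ k) :
    (spreadWalks G k).card ≤ k * (spreadLoops G k).card := by
  classical
  have hvalid : ∀ c ∈ (spreadWalks G k).image fun x => (List.ofFn x : Cycle V),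
      2 ≤ c.length ∧ c.Chain G.Adj := by
    simp only [Finset.mem_image, spreadWalks, Finset.mem_filter_univ]
    rintro _ ⟨x, ⟨hx, -⟩, rfl⟩
    exact ⟨by simpa using hk, chain_coe_ofFn.2 hx⟩
  have hcard : (spreadLoops G k).card =
      ((spreadWalks G k).image fun x => (List.ofFn x : Cycle V)).card := by
    refine (Finset.card_subtype _ _).trans (congrArg _ ?_)
    exact Finset.filter_true_of_mem hvalid
  rw [hcard]
  exact Finset.card_le_mul_card_image _ _ fun c _ =>
    card_filter_coe_ofFn_eq_le (by omega) _ c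

theorem card_pow_le_two_mul_card_spreadWalks (hk : 2 ≤ k) (hkV : 6 * k ≤ Fintype.card V) :
    Fintype.card V ^ k ≤ 2 * (spreadWalks (⊤ : SimpleGraph V) k).card := by
  have : DecidableEq V := Classical.decEq V
  have : NeZero k := ⟨by omega⟩
  have hrotate (i : Fin k) : finRotate k i ≠ i := by
    rw [← Equiv.Perm.mem_support, support_finRotate_of_le hk]
    exact Finset.mem_univ i
  have hstay := card_filter_exists_apply_eq_le (V := V) hrotate
  have hfew := card_filter_two_mul_ncard_range_le (ι := Fin k) (V := V)
  have hcover : (Finset.univ : Finset (Fin k → V)) ⊆ spreadWalks ⊤ k ∪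
      ((Finset.univ.filter fun x => ∃ i, x i = x (finRotate k i)) ∪
        Finset.univ.filter fun x => 2 * (Set.range x).ncard ≤ k) := by
    intro x _
    simp only [spreadWalks, Finset.mem_union, Finset.mem_filter_univ, SimpleGraph.top_adj]
    grind
  have hcount := (Finset.card_le_card hcover).trans <|
    (Finset.card_union_le _ _).trans <| Nat.add_le_add_left (Finset.card_union_le _ _) _
  rw [Fintype.card_fin] at hstay hfew
  rw [Finset.card_univ, Fintype.card_fun, Fintype.card_fin] at hcount
  have hpow : 6 * (k * Fintype.card V ^ (k - 1)) ≤ Fintype.card V ^ k :=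
    calc 6 * (k * Fintype.card V ^ (k - 1)) = 6 * k * Fintype.card V ^ (k - 1) := by ring
      _ ≤ Fintype.card V * Fintype.card V ^ (k - 1) := Nat.mul_le_mul_right _ hkV
      _ = Fintype.card V ^ k := mul_pow_sub_one (by omega) _
  linarith

end SpreadLoops

section CompleteNetwork

variable {n : ℕ} {κ : ℝ≥0}

theorem completeNetwork_graph : (completeNetwork n κ).graph = ⊤ := by
  ext u v
  simp [LoopNetwork.graph, completeNetwork]

theorem inv_le_completeNetwork_trans {u v : Fin n} (huv : u ≠ v) :
    ((n : ℝ≥0) + κ)⁻¹ ≤ (completeNetwork n κ).trans u v := by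
  have hcond : (completeNetwork n κ).cond u v = 1 := if_neg huv
  have hpos : 0 < (completeNetwork n κ).rate u := by
    refine add_pos_of_pos_of_nonneg ?_ zero_le
    exact (hcond ▸ one_pos).trans_le (Finset.single_le_sum (fun _ _ => zero_le) (Finset.mem_univ v))
  have hrate : (completeNetwork n κ).rate u ≤ n + κ := by
    refine add_le_add_left ?_ κ
    simpa using Finset.sum_le_card_nsmul Finset.univ ((completeNetwork n κ).cond u) 1
      fun w _ => by simp only [completeNetwork]; split_ifs <;> simp
  rw [LoopNetwork.trans, hcond, one_div]
  exact inv_anti₀ hpos hrate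

theorem exp_neg_div_two_mul_inv_le_sum_loopMass {k : ℕ} (hk : 2 ≤ k) (hkn : 6 * k ≤ n) :
    Real.exp (-κ) / 2 * (k : ℝ)⁻¹ ≤
      ∑ l ∈ spreadLoops (completeNetwork n κ).graph k, ((completeNetwork n κ).loopMass l : ℝ) := by
  set N := completeNetwork n κ
  have hmass : ∀ l ∈ spreadLoops N.graph k, (((n : ℝ) + κ)⁻¹) ^ k ≤ N.loopMass l := by
    intro l hl
    obtain ⟨rfl, hvertices⟩ := mem_spreadLoops.1 hl
    exact_mod_cast LoopNetwork.pow_length_le_loopMass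
      (fun u v huv => inv_le_completeNetwork_trans huv.ne) hvertices
  have hcard : (n : ℝ) ^ k ≤ 2 * (k * (spreadLoops N.graph k).card) := by
    have hwalks := card_pow_le_two_mul_card_spreadWalks (V := Fin n) hk (by simpa using hkn)
    rw [Fintype.card_fin, ← completeNetwork_graph (κ := κ)] at hwalks
    exact_mod_cast hwalks.trans (Nat.mul_le_mul_left 2 (card_spreadWalks_le hk))
  have hk0 : (0 : ℝ) < k := by positivity
  calc Real.exp (-κ) / 2 * (k : ℝ)⁻¹
      ≤ (n : ℝ) ^ k * (((n : ℝ) + κ)⁻¹) ^ k / 2 * (k : ℝ)⁻¹ := by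
        gcongr
        exact exp_neg_le_pow_mul_inv_pow κ.coe_nonneg (by omega) (by omega)
    _ ≤ 2 * (k * (spreadLoops N.graph k).card) * (((n : ℝ) + κ)⁻¹) ^ k / 2 * (k : ℝ)⁻¹ := by
        gcongr
    _ = (spreadLoops N.graph k).card • (((n : ℝ) + κ)⁻¹) ^ k := by
        rw [nsmul_eq_mul]
        field_simp
    _ ≤ ∑ l ∈ spreadLoops N.graph k, (N.loopMass l : ℝ) := Finset.card_nsmul_le_sum _ _ _ hmass

theorem exp_neg_div_two_mul_log_le_sum_loopMass {a b : ℕ} (ha : 1 ≤ a) (hb : 6 * b ≤ n)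
    [DecidableEq (DiscreteLoop (completeNetwork n κ).graph)] :
    Real.exp (-κ) / 2 * Real.log ((b + 1) / (a + 1)) ≤
      ∑ l ∈ (Finset.Ioc a b).biUnion (spreadLoops (completeNetwork n κ).graph),
        ((completeNetwork n κ).loopMass l : ℝ) := by
  have hdisjoint : (Finset.Ioc a b : Set ℕ).PairwiseDisjoint
      (spreadLoops (completeNetwork n κ).graph) := fun k _ m _ hkm =>
    Finset.disjoint_left.2 fun l hlk hlm =>
      hkm ((mem_spreadLoops.1 hlk).1.symm.trans (mem_spreadLoops.1 hlm).1)
  rw [Finset.sum_biUnion hdisjoint]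
  calc Real.exp (-κ) / 2 * Real.log ((b + 1) / (a + 1))
      ≤ Real.exp (-κ) / 2 * ∑ k ∈ Finset.Ioc a b, (k : ℝ)⁻¹ := by
        gcongr
        exact log_div_le_sum_Ioc_inv a b
    _ ≤ _ := by
        rw [Finset.mul_sum]
        refine Finset.sum_le_sum fun k hk => ?_
        rw [Finset.mem_Ioc] at hk
        exact exp_neg_div_two_mul_inv_le_sum_loopMass (by omega) (by omega)

theorem one_sub_rpow_le_loopEnsemble_exists_loop (α : ℝ≥0) {a b : ℕ} (ha : 1 ≤ a)
    (hb : 6 * b ≤ n) :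
    ENNReal.ofReal (1 - (((a : ℝ) + 1) / (b + 1)) ^ (α * Real.exp (-κ) / 2)) ≤
      (completeNetwork n κ).loopEnsemble α {ω | ∃ l, 0 < ω l ∧ a < 2 * l.vertices.ncard} := by
  classical
  set N := completeNetwork n κ
  set A := (Finset.Ioc a b).biUnion (spreadLoops N.graph)
  have hsubset : {ω : LoopConfig N.graph | ∃ l ∈ A, 0 < ω l} ⊆
      {ω | ∃ l, 0 < ω l ∧ a < 2 * l.vertices.ncard} := by
    rintro ω ⟨l, hlA, hl⟩
    obtain ⟨k, hk, hlk⟩ := Finset.mem_biUnion.1 hlA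
    exact ⟨l, hl, (Finset.mem_Ioc.1 hk).1.trans (mem_spreadLoops.1 hlk).2⟩
  refine le_trans ?_ (measure_mono hsubset)
  rw [LoopNetwork.loopEnsemble, infinitePi_poissonMeasure_exists_pos]
  refine ENNReal.ofReal_le_ofReal (sub_le_sub_left ?_ 1)
  rw [Real.rpow_def_of_pos (by positivity), Real.exp_le_exp, neg_le, ← inv_div, Real.log_inv]
  simp only [NNReal.coe_mul, ← Finset.mul_sum]
  calc -(-Real.log ((b + 1) / (a + 1)) * (α * Real.exp (-κ) / 2))
      = α * (Real.exp (-κ) / 2 * Real.log ((b + 1) / (a + 1))) := by ring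
    _ ≤ α * ∑ l ∈ A, (N.loopMass l : ℝ) := by
        gcongr
        exact exp_neg_div_two_mul_log_le_sum_loopMass ha hb

end CompleteNetwork

instance {V : Type*} [Fintype V] (N : LoopNetwork V) (α : ℝ≥0) :
    IsProbabilityMeasure (N.loopEnsemble α) := by
  unfold LoopNetwork.loopEnsemble
  infer_instance

theorem tendsto_loopEnsemble_exists_loop {α : ℝ≥0} (hα : 0 < α) (κ : ℝ≥0) {u : ℕ → ℝ}
    (hu : u =o[atTop] fun n => (n : ℝ)) :
    Tendsto (fun n => (completeNetwork n κ).loopEnsemble α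
      {ω | ∃ l, 0 < ω l ∧ u n < l.vertices.ncard}) atTop (𝓝 1) := by
  let a (n : ℕ) : ℕ := ⌈2 * |u n|⌉₊ + 1
  have hratio : Tendsto (fun n : ℕ => ((a n : ℝ) + 1) / ((n / 6 : ℕ) + 1)) atTop (𝓝 0) := by
    have hnum : (fun n => (a n : ℝ) + 1) =o[atTop] fun n : ℕ => (n : ℝ) := by
      have hconst : (fun _ : ℕ => (3 : ℝ)) =o[atTop] fun n : ℕ => (n : ℝ) :=
        isLittleO_const_id_atTop 3 |>.natCast_atTop
      refine IsBigO.trans_isLittleO (.of_norm_le fun n => ?_)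
        ((hu.abs_left.const_mul_left 2).add hconst)
      rw [Real.norm_of_nonneg (by positivity)]
      push_cast [a]
      linarith [Nat.ceil_lt_add_one (show 0 ≤ 2 * |u n| by positivity)]
    have hden : (fun n : ℕ => (n : ℝ)) =O[atTop] fun n : ℕ => ((n / 6 : ℕ) : ℝ) + 1 := by
      refine .of_bound 6 (.of_forall fun n => ?_)
      rw [Real.norm_of_nonneg (by positivity), Real.norm_of_nonneg (by positivity)]
      exact_mod_cast (by omega : n ≤ 6 * (n / 6 + 1))
    exact (hnum.trans_isBigO hden).tendsto_div_nhds_zero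
  have hlower : Tendsto (fun n => ENNReal.ofReal
      (1 - (((a n : ℝ) + 1) / ((n / 6 : ℕ) + 1)) ^ (α * Real.exp (-κ) / 2))) atTop (𝓝 1) := by
    have hexponent : 0 < α * Real.exp (-κ) / 2 := by positivity
    have hrpow := (hratio.rpow_const (.inr hexponent.le)).const_sub 1
    rw [Real.zero_rpow hexponent.ne', sub_zero] at hrpow
    simpa using ENNReal.tendsto_ofReal hrpow
  refine tendsto_of_tendsto_of_tendsto_of_le_of_le hlower tendsto_const_nhds
    (fun n => (one_sub_rpow_le_loopEnsemble_exists_loop α (Nat.le_add_left 1 _)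
      (Nat.mul_div_le n 6)).trans (measure_mono ?_)) fun _ => prob_le_one
  rintro ω ⟨l, hl, hal⟩
  refine ⟨l, hl, ?_⟩
  have hceil := Nat.le_ceil (2 * |u n|)
  have habs := le_abs_self (u n)
  have hal : ((⌈2 * |u n|⌉₊ + 1 : ℕ) : ℝ) < 2 * l.vertices.ncard := by exact_mod_cast hal
  push_cast at hal
  linarith

theorem mainTheorem5_general {α : ℝ≥0} (hα : 0 < α) (κ : ℝ≥0) {s t : ℕ → ℝ}
    (hs : s =o[atTop] fun n => (n : ℝ)) (ht : t =o[atTop] fun n => (n : ℝ)) :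
    Tendsto (fun n : ℕ => (completeNetwork n κ).loopEnsemble α
        {ω | ∃ B ∈ loopClusters ω, s n < (B.ncard : ℝ)})
      atTop (𝓝 1) ∧
    Tendsto (fun n : ℕ => (completeNetwork n κ).loopEnsemble α
        {ω | ∃ l : DiscreteLoop (completeNetwork n κ).graph, 0 < ω l ∧
          s n < (l.1.length : ℝ) ∧ t n < (l.vertices.ncard : ℝ)})
      atTop (𝓝 1) := by
  constructor
  · refine tendsto_measure_one_of_subset (tendsto_loopEnsemble_exists_loop hα κ hs) fun n => ?_
    rintro ω ⟨l, hl, hsl⟩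
    obtain ⟨B, hB, hlB⟩ := exists_mem_loopClusters_vertices_subset hl
    exact ⟨B, hB, hsl.trans_le (Nat.cast_le.2 (Set.ncard_le_ncard hlB))⟩
  · have hst : (fun n => |s n| + |t n|) =o[atTop] fun n => (n : ℝ) := hs.abs_left.add ht.abs_left
    refine tendsto_measure_one_of_subset (tendsto_loopEnsemble_exists_loop hα κ hst) fun n => ?_
    rintro ω ⟨l, hl, hstl⟩
    have hsl : s n < l.vertices.ncard := by linarith [le_abs_self (s n), abs_nonneg (t n)]
    have htl : t n < l.vertices.ncard := by linarith [le_abs_self (t n), abs_nonneg (s n)]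
    exact ⟨l, hl, hsl.trans_le (Nat.cast_le.2 l.ncard_vertices_le_length), htl⟩

theorem mainTheorem5 (α κ : ℝ≥0) (hα : 0 < α) (hκ : 0 < κ) (ε : ℝ) (hε₀ : 0 < ε) (hε₁ : ε < 1) :
    Tendsto (fun n : ℕ => (completeNetwork n κ).loopEnsemble α
        {ω | ∃ B ∈ loopClusters ω, (n : ℝ) ^ (1 - ε) < (B.ncard : ℝ)})
      atTop (𝓝 1) ∧
    Tendsto (fun n : ℕ => (completeNetwork n κ).loopEnsemble α
        {ω | ∃ l : DiscreteLoop (completeNetwork n κ).graph, 0 < ω l ∧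
          (n : ℝ) ^ (1 - ε) < (l.1.length : ℝ) ∧
          (1 - ε) * (n : ℝ) ^ (1 - ε) < (l.vertices.ncard : ℝ)})
      atTop (𝓝 1) :=
  have hpow := isLittleO_natCast_rpow (sub_lt_self 1 hε₀)
  mainTheorem5_general hα κ hpow (hpow.const_mul_left (1 - ε))
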